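/- For $\beta\in(0,\pi)$ let $\mathcal O_\beta$ be the pair of lines through the origin with slopes $0$ and $\tan\beta$ (the second one vertical if $\beta=\pi/2$). An $\mathcal O_\beta$-quadrant (top-right, top-left, bottom-left or bottom-right) is a translate of one of the four open regions into which the two lines divide the plane. Let $P\subset\mathbb R^2$ be a finite set of at least two points, no three of them collinear and no two of them on a horizontal line. A region is $P$-free if it contains no point of $P$. The $\mathcal O_\beta$-hull $\mathcal O_\beta\mathcal H(P)$ is the complement in $\mathbb R^2$ of the union of all $P$-free $\mathcal O_\beta$-quadrants. For each of the four types of quadrants, the vertices of the $\mathcal O_\beta$-staircase of that type are the points $p\in P$ such that the quadrant of that type with apex $p$ is $P$-free; two vertices of a staircase are consecutive if no vertex of it lies vertically between them. Two consecutive vertices of a staircase define a maximal quadrant, namely the quadrant of its type that has both of them on its boundary, one on each of its two bounding rays. An overlapping region is a nonempty intersection of two maximal quadrants of opposite types; it is identified by those types together with the two pairs of consecutive vertices that define the quadrants. An angle $\beta_0\in(0,\pi)$ is an event if, as $\beta$ increases through $\beta_0$, some point of $P$ joins or leaves the set of vertices of one of the four staircases (insertion or deletion event), or some overlapping region is created or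 destroyed (overlap or release event); here joining and being created mean being absent for all $\beta<\beta_0$ close to $\beta_0$ and present for all $\beta>\beta_0$ close to $\beta_0$, and leaving and being destroyed mean the reverse. Then: 1. The set of events is finite, and the maximum of $\operatorname{area}(\mathcal O_\beta\mathcal H(P))$ over $\beta\in(0,\pi)$ is attained at an event: there is an event $\beta_0$ with $\operatorname{area}(\mathcal O_\beta\mathcal H(P))\le \operatorname{area}(\mathcal O_{\beta_0}\mathcal H(P))$ for all $\beta\in(0,\pi)$. 2. If $\beta_1<\beta_2$ are consecutive events (no event lies strictly between them), then there are real constants $A,B$ such that $\operatorname{area}(\mathcal O_\beta\mathcal H(P))=A+B\cot\beta$ for all $\beta\in[\beta_1,\beta_2]$; in particular the area is monotone (non-decreasing or non-increasing) on $[\beta_1,\beta_2]$. -/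

import Mathlib

open Set Filter Topology MeasureTheory

/-!
Throughout, `β ∈ (0, π)` is an angle, and `O_β` is the pair consisting of the horizontal line and
the line of slope `tan β` (vertical for `β = π / 2`) through the origin.
-/

noncomputable section

namespace OBeta

/-- The horizontal coordinate of `p` in the coordinate system defined by the lines of `O_β`:
`p = (u, 0) + (v cot β, v)` where `u = skewX β p` and `v = p.2`. The line with slope `tan β`
through `a` is `{p | skewX β p = skewX β a}`, and the points to the right of it are those with a
larger value of `skewX β`. -/
def skewX (β : ℝ) (p : ℝ × ℝ) : ℝ := p.1 - p.2 * Real.cot β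

/-- The four types of `O_β`-quadrants. -/
inductive Corner where
  | topRight
  | topLeft
  | bottomLeft
  | bottomRight

/-- The type of the opposite quadrants. -/
def Corner.opposite : Corner → Corner
  | .topRight => .bottomLeft
  | .topLeft => .bottomRight
  | .bottomLeft => .topRight
  | .bottomRight => .topLeft

/-- The (open) `O_β`-quadrant of the given type with apex `a`. -/
def quadrant (β : ℝ) : Corner → ℝ × ℝ → Set (ℝ × ℝ)
  | .topRight, a => {p | skewX β a < skewX β p ∧ a.2 < p.2}
  | .topLeft, a => {p | skewX β p < skewX β a ∧ a.2 < p.2}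
  | .bottomLeft, a => {p | skewX β p < skewX β a ∧ p.2 < a.2}
  | .bottomRight, a => {p | skewX β a < skewX β p ∧ p.2 < a.2}

/-- A region is `P`-free if it contains no element of `P`. -/
def IsFree (P : Finset (ℝ × ℝ)) (R : Set (ℝ × ℝ)) : Prop := ∀ p ∈ P, p ∉ R

/-- The `O_β`-hull of `P`: the complement of the union of all `P`-free `O_β`-quadrants. -/
def hull (P : Finset (ℝ × ℝ)) (β : ℝ) : Set (ℝ × ℝ) :=
  {z | ∀ (s : Corner) (a : ℝ × ℝ), IsFree P (quadrant β s a) → z ∉ quadrant β s a}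

/-- The area of the `O_β`-hull of `P` (it is finite, see `volume_hull_lt_top`). -/
def area (P : Finset (ℝ × ℝ)) (β : ℝ) : ℝ := (volume (hull P β)).toReal

/-- `p` is a vertex on the `O_β`-staircase of type `s` of `P`: it is a point of `P` and the
quadrant of type `s` with apex `p` is `P`-free. -/
def IsStairVertex (P : Finset (ℝ × ℝ)) (β : ℝ) (s : Corner) (p : ℝ × ℝ) : Prop :=
  p ∈ P ∧ IsFree P (quadrant β s p)

/-- `lo` and `hi` are consecutive vertices of the `O_β`-staircase of type `s`, `lo` being the lower
one. (Staircases are monotone, so that their vertices are met in vertical order.) -/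
def IsConsecutive (P : Finset (ℝ × ℝ)) (β : ℝ) (s : Corner) (lo hi : ℝ × ℝ) : Prop :=
  IsStairVertex P β s lo ∧ IsStairVertex P β s hi ∧ lo.2 < hi.2 ∧
    ∀ r, IsStairVertex P β s r → ¬ (lo.2 < r.2 ∧ r.2 < hi.2)

/-- The apex of the quadrant of type `s` whose boundary joins the consecutive vertices `lo` and
`hi` of the staircase of type `s`. For the top quadrants, `hi` lies on the ray of slope `tan β` and
`lo` on the horizontal ray; for the bottom quadrants it is the other way round. -/
def apex (β : ℝ) : Corner → ℝ × ℝ → ℝ × ℝ → ℝ × ℝ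
  | .topRight, lo, hi | .topLeft, lo, hi => (skewX β hi + lo.2 * Real.cot β, lo.2)
  | .bottomLeft, lo, hi | .bottomRight, lo, hi => (skewX β lo + hi.2 * Real.cot β, hi.2)

/-- At the angle `β` there is an overlapping region supported by the vertices `lo, hi` of the
staircase of type `s` and the vertices `lo', hi'` of the opposite staircase: each pair consists of
consecutive vertices, and the two maximal quadrants that they define intersect. -/
def IsOverlap (P : Finset (ℝ × ℝ)) (β : ℝ) (s : Corner) (lo hi lo' hi' : ℝ × ℝ) : Prop :=
  IsConsecutive P β s lo hi ∧ IsConsecutive P β s.opposite lo' hi' ∧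
    (quadrant β s (apex β s lo hi) ∩
      quadrant β s.opposite (apex β s.opposite lo' hi')).Nonempty

/-- In an increasing sweep, `F` starts to hold at the angle `β`: it fails just before `β` and holds
just after `β`. -/
def StartsAt (F : ℝ → Prop) (β : ℝ) : Prop :=
  (∀ᶠ b in 𝓝[<] β, ¬ F b) ∧ ∀ᶠ b in 𝓝[>] β, F b

/-- In an increasing sweep, `F` ceases to hold at the angle `β`: it holds just before `β` and fails
just after `β`. -/
def StopsAt (F : ℝ → Prop) (β : ℝ) : Prop :=
  (∀ᶠ b in 𝓝[<] β, F b) ∧ ∀ᶠ b in 𝓝[>] β, ¬ F b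

/-- Insertion event: a vertex joins a staircase. -/
def IsInsertionEvent (P : Finset (ℝ × ℝ)) (β : ℝ) : Prop :=
  ∃ s p, StartsAt (fun b => IsStairVertex P b s p) β

/-- Deletion event: a vertex leaves a staircase. -/
def IsDeletionEvent (P : Finset (ℝ × ℝ)) (β : ℝ) : Prop :=
  ∃ s p, StopsAt (fun b => IsStairVertex P b s p) β

/-- Overlap event: an overlapping region is created. -/
def IsOverlapEvent (P : Finset (ℝ × ℝ)) (β : ℝ) : Prop :=
  ∃ s lo hi lo' hi', StartsAt (fun b => IsOverlap P b s lo hi lo' hi') β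

/-- Release event: an overlapping region is destroyed. -/
def IsReleaseEvent (P : Finset (ℝ × ℝ)) (β : ℝ) : Prop :=
  ∃ s lo hi lo' hi', StopsAt (fun b => IsOverlap P b s lo hi lo' hi') β

/-- The set of event angles of `P` during a complete angular sweep. -/
def events (P : Finset (ℝ × ℝ)) : Set ℝ :=
  {β | β ∈ Ioo 0 Real.pi ∧
    (IsInsertionEvent P β ∨ IsDeletionEvent P β ∨ IsOverlapEvent P β ∨ IsReleaseEvent P β)}

/-- The hull has finite area, so that `area` is a genuine area. -/
theorem volume_hull_lt_top (P : Finset (ℝ × ℝ)) (β : ℝ) : volume (hull P β) < ⊤ := by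
  obtain ⟨M, hM⟩ := (P.image fun p => |skewX β p| + |p.2|).bddAbove
  have hP : ∀ p ∈ P, |skewX β p| ≤ M ∧ |p.2| ≤ M := fun p hp => by
    have h := hM (Finset.mem_coe.2 (Finset.mem_image_of_mem _ hp))
    constructor <;> linarith [abs_nonneg (skewX β p), abs_nonneg p.2]
  have hsub : hull P β ⊆ Icc (-(M + M * |Real.cot β|)) (M + M * |Real.cot β|) ×ˢ Icc (-M) M := by
    intro z hz
    have key : ∀ u v : ℝ, skewX β (u + v * Real.cot β, v) = u := fun u v => by simp [skewX]
    have h1 : z.2 ≤ M := by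
      by_contra! h
      refine hz .topRight (skewX β z - 1 + M * Real.cot β, M) (fun p hp hq => ?_) ?_
      · have := hq.2
        linarith [(abs_le.1 (hP p hp).2).2]
      · simp only [quadrant, mem_ofPred_eq, key]
        exact ⟨by linarith, h⟩
    have h2 : -M ≤ z.2 := by
      by_contra! h
      refine hz .bottomRight (skewX β z - 1 + (-M) * Real.cot β, -M) (fun p hp hq => ?_) ?_
      · have := hq.2
        linarith [(abs_le.1 (hP p hp).2).1]
      · simp only [quadrant, mem_ofPred_eq, key]
        exact ⟨by linarith, h⟩
    have h3 : skewX β z ≤ M := by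
      by_contra! h
      refine hz .topRight (M + (z.2 - 1) * Real.cot β, z.2 - 1) (fun p hp hq => ?_) ?_
      · have := hq.1
        rw [key] at this
        linarith [(abs_le.1 (hP p hp).1).2]
      · simp only [quadrant, mem_ofPred_eq, key]
        exact ⟨h, by linarith⟩
    have h4 : -M ≤ skewX β z := by
      by_contra! h
      refine hz .topLeft (-M + (z.2 - 1) * Real.cot β, z.2 - 1) (fun p hp hq => ?_) ?_
      · have := hq.1
        rw [key] at this
        linarith [(abs_le.1 (hP p hp).1).1]
      · simp only [quadrant, mem_ofPred_eq, key]
        exact ⟨h, by linarith⟩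
    have h5 : |z.2 * Real.cot β| ≤ M * |Real.cot β| := by
      rw [abs_mul]
      exact mul_le_mul_of_nonneg_right (abs_le.2 ⟨h2, h1⟩) (abs_nonneg _)
    have h6 := abs_le.1 h5
    have h7 : z.1 = skewX β z + z.2 * Real.cot β := by simp [skewX]
    exact ⟨⟨by linarith, by linarith⟩, h2, h1⟩
  exact (measure_mono hsub).trans_lt (isCompact_Icc.prod isCompact_Icc).measure_lt_top

end OBeta

end

/-! The hull is cut into horizontal slices. At a height `v` that is not the height of a point of
`P`, each of the four quadrant types bounds the slice on one side by an extreme skew coordinate of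
the points above or below `v` (`width_eq`). Skew coordinates are affine in `cot β`, so the slice
length is affine in `cot β` as long as the extreme points and the comparisons among them do not
change. Staircases determine the extreme points and which one bounds each side of the slice;
overlapping regions decide whether opposite bounds cross and leave the slice empty
(`exists_width_eq_affine`).

At a non-event the order of `P` may change, but staircases and overlaps agree on both sides. Hence
the length is locally affine in `cot β`; the identity theorem for analytic functions and continuity
extend this to the closed interval between events, and integration over `v` gives the area.

An affine function of the cotangent is monotone, so between events the area is bounded by its values
at the two ends. Before the first and after the last event the area vanishes: there it is affine in
`cot β` and zero for angles close to `0` or `π`. Events are finite in number because each requires a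
line of slope `tan β` through two points of `P`. -/

noncomputable section
namespace OBeta

/-! ### Quadrants in signed coordinates and the hull through closed quadrants. -/

/-- The horizontal direction in which the quadrants of the given type extend. -/
def Corner.sgnX : Corner → ℝ
  | .topRight | .bottomRight => 1
  | .topLeft | .bottomLeft => -1

/-- The vertical direction in which the quadrants of the given type extend. -/
def Corner.sgnY : Corner → ℝ
  | .topRight | .topLeft => 1
  | .bottomLeft | .bottomRight => -1

theorem Corner.sgnX_mul_self (s : Corner) : s.sgnX * s.sgnX = 1 := by cases s <;> simp [sgnX]

theorem Corner.sgnY_mul_self (s : Corner) : s.sgnY * s.sgnY = 1 := by cases s <;> simp [sgnY]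

theorem Corner.sgnX_ne_zero (s : Corner) : s.sgnX ≠ 0 := by cases s <;> simp [sgnX]

theorem Corner.sgnY_ne_zero (s : Corner) : s.sgnY ≠ 0 := by cases s <;> simp [sgnY]

theorem Corner.sgnX_opposite (s : Corner) : s.opposite.sgnX = -s.sgnX := by
  cases s <;> simp [sgnX, opposite]

theorem Corner.sgnY_opposite (s : Corner) : s.opposite.sgnY = -s.sgnY := by
  cases s <;> simp [sgnY, opposite]

theorem mem_quadrant {β : ℝ} {s : Corner} {a p : ℝ × ℝ} :
    p ∈ quadrant β s a ↔
      s.sgnX * skewX β a < s.sgnX * skewX β p ∧ s.sgnY * a.2 < s.sgnY * p.2 := by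
  cases s <;> simp [quadrant, Corner.sgnX, Corner.sgnY]

theorem exists_skewX_eq (β u v : ℝ) : ∃ a : ℝ × ℝ, skewX β a = u ∧ a.2 = v :=
  ⟨(u + v * Real.cot β, v), by simp [skewX], rfl⟩

/-- If the closed quadrant at `z` misses the finite set `P`, moving its apex outwards by a small `ε`
keeps it free and puts `z` in the open quadrant. This removes the quantifier over all apices. -/
theorem mem_hull_iff {P : Finset (ℝ × ℝ)} {β : ℝ} {z : ℝ × ℝ} :
    z ∈ hull P β ↔ ∀ s : Corner, ∃ p ∈ P,
      s.sgnX * skewX β z ≤ s.sgnX * skewX β p ∧ s.sgnY * z.2 ≤ s.sgnY * p.2 := by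
  constructor
  · intro hz s
    by_contra! h
    have hev : ∀ᶠ ε in 𝓝[>] (0 : ℝ), ∀ p ∈ P,
        ¬ (s.sgnX * skewX β z - ε < s.sgnX * skewX β p ∧ s.sgnY * z.2 - ε < s.sgnY * p.2) := by
      refine (Filter.eventually_all_finset P).2 fun p hp => ?_
      rcases le_or_gt (s.sgnX * skewX β z) (s.sgnX * skewX β p) with h1 | h1
      · have h2 := h p hp h1
        filter_upwards [Ioo_mem_nhdsGT (sub_pos.2 h2)] with ε hε h3
        linarith [hε.2, h3.2]
      · filter_upwards [Ioo_mem_nhdsGT (sub_pos.2 h1)] with ε hε h3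
        linarith [hε.2, h3.1]
    obtain ⟨ε, hε, hε0⟩ := (hev.and self_mem_nhdsWithin).exists
    have hε0 : 0 < ε := hε0
    obtain ⟨a, ha1, ha2⟩ := exists_skewX_eq β (skewX β z - s.sgnX * ε) (z.2 - s.sgnY * ε)
    have e1 : s.sgnX * skewX β a = s.sgnX * skewX β z - ε := by
      rw [ha1, mul_sub, ← mul_assoc, s.sgnX_mul_self, one_mul]
    have e2 : s.sgnY * a.2 = s.sgnY * z.2 - ε := by
      rw [ha2, mul_sub, ← mul_assoc, s.sgnY_mul_self, one_mul]
    refine hz s a (fun p hp hq => hε p hp ?_) ?_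
    · rwa [mem_quadrant, e1, e2] at hq
    · rw [mem_quadrant, e1, e2]
      constructor <;> linarith
  · intro h s a hfree hz
    obtain ⟨p, hp, h1, h2⟩ := h s
    rw [mem_quadrant] at hz
    exact hfree p hp (mem_quadrant.2 ⟨hz.1.trans_le h1, hz.2.trans_le h2⟩)

theorem continuous_skewX (β : ℝ) : Continuous (skewX β) := by
  unfold skewX
  fun_prop

theorem isClosed_hull (P : Finset (ℝ × ℝ)) (β : ℝ) : IsClosed (hull P β) := by
  have : hull P β = ⋂ s : Corner, ⋃ p ∈ (P : Set (ℝ × ℝ)), {z : ℝ × ℝ |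
      s.sgnX * skewX β z ≤ s.sgnX * skewX β p ∧ s.sgnY * z.2 ≤ s.sgnY * p.2} := by
    ext z
    simp only [mem_hull_iff, mem_iInter, mem_iUnion, mem_ofPred_eq, Finset.mem_coe, exists_prop]
  rw [this]
  refine isClosed_iInter fun s => P.finite_toSet.isClosed_biUnion fun p _ => ?_
  exact (isClosed_le (continuous_const.mul (continuous_skewX β)) continuous_const).inter
    (isClosed_le (continuous_const.mul continuous_snd) continuous_const)

/-! ### Horizontal slices of the hull. -/

/-- The length of the horizontal slice of the hull at height `v`. -/
def width (P : Finset (ℝ × ℝ)) (v β : ℝ) : ℝ :=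
  (volume ((fun x : ℝ => (x, v)) ⁻¹' hull P β)).toReal

theorem lintegral_slice (P : Finset (ℝ × ℝ)) (β : ℝ) :
    ∫⁻ v, volume ((fun x : ℝ => (x, v)) ⁻¹' hull P β) = volume (hull P β) := by
  rw [Measure.volume_eq_prod, Measure.prod_apply_symm (isClosed_hull P β).measurableSet]

theorem measurable_slice (P : Finset (ℝ × ℝ)) (β : ℝ) :
    Measurable fun v : ℝ => volume ((fun x : ℝ => (x, v)) ⁻¹' hull P β) :=
  measurable_measure_prodMk_right (isClosed_hull P β).measurableSet

theorem integrable_width (P : Finset (ℝ × ℝ)) (β : ℝ) : Integrable fun v => width P v β := by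
  refine integrable_toReal_of_lintegral_ne_top (measurable_slice P β).aemeasurable ?_
  rw [lintegral_slice]
  exact (volume_hull_lt_top P β).ne

theorem area_eq_integral (P : Finset (ℝ × ℝ)) (β : ℝ) : area P β = ∫ v, width P v β := by
  unfold width area
  rw [integral_toReal (measurable_slice P β).aemeasurable, lintegral_slice]
  refine ae_lt_top (measurable_slice P β) ?_
  rw [lintegral_slice]
  exact (volume_hull_lt_top P β).ne

/-- Heights of points of `P` are negligible for the integral; away from them every point is strictly
above or strictly below the slice. -/
theorem ae_forall_ne_snd (P : Finset (ℝ × ℝ)) : ∀ᵐ v : ℝ, ∀ p ∈ P, p.2 ≠ v := by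
  refine (ae_ball_iff P.countable_toSet).2 fun p _ => ?_
  have : ∀ᵐ v : ℝ, v ≠ p.2 := by simp [ae_iff]
  exact this.mono fun v hv h => hv h.symm

/-- The points of `P` above the height `v`. -/
def above (P : Finset (ℝ × ℝ)) (v : ℝ) : Finset (ℝ × ℝ) := P.filter fun p => v < p.2

/-- The points of `P` below the height `v`. -/
def below (P : Finset (ℝ × ℝ)) (v : ℝ) : Finset (ℝ × ℝ) := P.filter fun p => p.2 < v

theorem mem_above {P : Finset (ℝ × ℝ)} {v : ℝ} {p : ℝ × ℝ} : p ∈ above P v ↔ p ∈ P ∧ v < p.2 :=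
  Finset.mem_filter

theorem mem_below {P : Finset (ℝ × ℝ)} {v : ℝ} {p : ℝ × ℝ} : p ∈ below P v ↔ p ∈ P ∧ p.2 < v :=
  Finset.mem_filter

theorem width_of_above_eq_empty {P : Finset (ℝ × ℝ)} {v : ℝ} (hv : ∀ p ∈ P, p.2 ≠ v)
    (h : above P v = ∅) (β : ℝ) : width P v β = 0 := by
  have : (fun x : ℝ => (x, v)) ⁻¹' hull P β = ∅ := by
    refine eq_empty_of_forall_notMem fun x hx => ?_
    obtain ⟨p, hp, -, h2⟩ := mem_hull_iff.1 hx .topRight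
    simp only [Corner.sgnY, one_mul] at h2
    exact Finset.notMem_empty p (h ▸ mem_above.2 ⟨hp, h2.lt_of_ne (hv p hp).symm⟩)
  simp [width, this]

theorem width_of_below_eq_empty {P : Finset (ℝ × ℝ)} {v : ℝ} (hv : ∀ p ∈ P, p.2 ≠ v)
    (h : below P v = ∅) (β : ℝ) : width P v β = 0 := by
  have : (fun x : ℝ => (x, v)) ⁻¹' hull P β = ∅ := by
    refine eq_empty_of_forall_notMem fun x hx => ?_
    obtain ⟨p, hp, -, h2⟩ := mem_hull_iff.1 hx .bottomRight
    simp only [Corner.sgnY, neg_one_mul, neg_le_neg_iff] at h2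
    exact Finset.notMem_empty p (h ▸ mem_below.2 ⟨hp, h2.lt_of_ne (hv p hp)⟩)
  simp [width, this]

/-- Top types constrain the slice by the points above `v`, bottom types by those below; right types
bound it from the right, left types from the left. The outer `max 0` covers crossing bounds, when
the slice is empty. -/
theorem width_eq {P : Finset (ℝ × ℝ)} {v : ℝ} (hv : ∀ p ∈ P, p.2 ≠ v)
    (hU : (above P v).Nonempty) (hD : (below P v).Nonempty) (β : ℝ) :
    width P v β = max 0
      (min ((above P v).sup' hU (skewX β)) ((below P v).sup' hD (skewX β)) -
        max ((above P v).inf' hU (skewX β)) ((below P v).inf' hD (skewX β))) := by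
  have : (fun x : ℝ => (x, v)) ⁻¹' hull P β =
      Icc (max ((above P v).inf' hU (skewX β)) ((below P v).inf' hD (skewX β)) + v * Real.cot β)
        (min ((above P v).sup' hU (skewX β)) ((below P v).sup' hD (skewX β)) +
          v * Real.cot β) := by
    ext x
    have e : skewX β (x, v) = x - v * Real.cot β := rfl
    rw [mem_Icc, ← le_sub_iff_add_le, ← sub_le_iff_le_add, ← e, max_le_iff, le_min_iff,
      Finset.le_sup'_iff, Finset.le_sup'_iff, Finset.inf'_le_iff, Finset.inf'_le_iff,
      mem_preimage, mem_hull_iff]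
    have hlt : ∀ p ∈ P, (v ≤ p.2 ↔ v < p.2) := fun p hp => (hv p hp).symm.le_iff_lt
    have hgt : ∀ p ∈ P, (p.2 ≤ v ↔ p.2 < v) := fun p hp => (hv p hp).le_iff_lt
    constructor
    · intro h
      obtain ⟨i, hi, hi1, hi2⟩ := h .topRight
      obtain ⟨j, hj, hj1, hj2⟩ := h .bottomRight
      obtain ⟨k, hk, hk1, hk2⟩ := h .topLeft
      obtain ⟨l, hl, hl1, hl2⟩ := h .bottomLeft
      simp only [Corner.sgnX, Corner.sgnY, one_mul, neg_one_mul, neg_le_neg_iff] at *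
      exact ⟨⟨⟨k, mem_above.2 ⟨hk, (hlt k hk).1 hk2⟩, hk1⟩,
        ⟨l, mem_below.2 ⟨hl, (hgt l hl).1 hl2⟩, hl1⟩⟩,
        ⟨⟨i, mem_above.2 ⟨hi, (hlt i hi).1 hi2⟩, hi1⟩,
        ⟨j, mem_below.2 ⟨hj, (hgt j hj).1 hj2⟩, hj1⟩⟩⟩
    · rintro ⟨⟨⟨k, hk, hk1⟩, ⟨l, hl, hl1⟩⟩, ⟨⟨i, hi, hi1⟩, ⟨j, hj, hj1⟩⟩⟩ s
      rw [mem_above] at hi hk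
      rw [mem_below] at hj hl
      cases s <;> simp only [Corner.sgnX, Corner.sgnY, one_mul, neg_one_mul, neg_le_neg_iff]
      · exact ⟨i, hi.1, hi1, hi.2.le⟩
      · exact ⟨k, hk.1, hk1, hk.2.le⟩
      · exact ⟨l, hl.1, hl1, hl.2.le⟩
      · exact ⟨j, hj.1, hj1, hj.2.le⟩
  rw [width, this, Real.volume_Icc, add_sub_add_right_eq_sub, ENNReal.toReal_ofReal', max_comm]

/-! ### The cotangent on `(0, π)` -/

theorem cot_eq_tan (β : ℝ) : Real.cot β = Real.tan (Real.pi / 2 - β) := by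
  rw [Real.tan_pi_div_two_sub, Real.cot_eq_cos_div_sin, Real.tan_eq_sin_div_cos, inv_div]

theorem strictAntiOn_cot : StrictAntiOn Real.cot (Ioo 0 Real.pi) := by
  intro a ha b hb hab
  rw [cot_eq_tan, cot_eq_tan]
  refine Real.strictMonoOn_tan ⟨?_, ?_⟩ ⟨?_, ?_⟩ ?_ <;> linarith [ha.1, ha.2, hb.1, hb.2]

theorem exists_cot_eq (t : ℝ) : ∃ β ∈ Ioo 0 Real.pi, Real.cot β = t := by
  refine ⟨Real.pi / 2 - Real.arctan t, ⟨?_, ?_⟩, ?_⟩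
  · linarith [Real.arctan_lt_pi_div_two t]
  · linarith [Real.neg_pi_div_two_lt_arctan t]
  · rw [cot_eq_tan, sub_sub_cancel, Real.tan_arctan]

theorem analyticAt_cot {β : ℝ} (hβ : β ∈ Ioo 0 Real.pi) : AnalyticAt ℝ Real.cot β := by
  have : Real.cot = fun x => Real.cos x / Real.sin x := funext Real.cot_eq_cos_div_sin
  rw [this]
  exact Real.analyticAt_cos.div Real.analyticAt_sin (Real.sin_pos_of_mem_Ioo hβ).ne'

theorem continuousAt_cot {β : ℝ} (hβ : β ∈ Ioo 0 Real.pi) : ContinuousAt Real.cot β :=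
  (analyticAt_cot hβ).continuousAt

theorem continuousAt_skewX {β : ℝ} (hβ : β ∈ Ioo 0 Real.pi) (p : ℝ × ℝ) :
    ContinuousAt (fun b => skewX b p) β := by
  have := continuousAt_cot hβ
  unfold skewX
  fun_prop

theorem continuousAt_width {P : Finset (ℝ × ℝ)} {v : ℝ} (hv : ∀ p ∈ P, p.2 ≠ v) {β : ℝ}
    (hβ : β ∈ Ioo 0 Real.pi) : ContinuousAt (fun b => width P v b) β := by
  rcases (above P v).eq_empty_or_nonempty with hU | hU
  · simp only [width_of_above_eq_empty hv hU]
    exact continuousAt_const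
  rcases (below P v).eq_empty_or_nonempty with hD | hD
  · simp only [width_of_below_eq_empty hv hD]
    exact continuousAt_const
  simp only [width_eq hv hU hD]
  have h1 := ContinuousAt.finset_sup'_apply hU fun p _ => continuousAt_skewX hβ p
  have h2 := ContinuousAt.finset_sup'_apply hD fun p _ => continuousAt_skewX hβ p
  have h3 := ContinuousAt.finset_inf'_apply hU fun p _ => continuousAt_skewX hβ p
  have h4 := ContinuousAt.finset_inf'_apply hD fun p _ => continuousAt_skewX hβ p
  exact continuousAt_const.max ((h1.min h2).sub (h3.max h4))

end OBeta
end

noncomputable section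
namespace OBeta

/-! ### Extreme points of the upper and lower parts of `P` -/

/-- Among the points of `P` that lie beyond the height `v` in the vertical direction of `s`, the
point `p` is extreme in the horizontal direction of `s`. -/
def IsExtreme (P : Finset (ℝ × ℝ)) (b : ℝ) (s : Corner) (v : ℝ) (p : ℝ × ℝ) : Prop :=
  p ∈ P ∧ s.sgnY * v < s.sgnY * p.2 ∧
    ∀ q ∈ P, s.sgnY * v < s.sgnY * q.2 → s.sgnX * skewX b q ≤ s.sgnX * skewX b p

/-- The angles `b` and `b'` give rise to the same staircases and overlapping regions, and no line
of slope `tan b` or `tan b'` contains two points of `P`. -/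
structure Similar (P : Finset (ℝ × ℝ)) (b b' : ℝ) : Prop where
  injOn : InjOn (skewX b) P
  injOn' : InjOn (skewX b') P
  stair : ∀ s p, IsStairVertex P b s p ↔ IsStairVertex P b' s p
  overlap : ∀ s lo hi lo' hi', IsOverlap P b s lo hi lo' hi' ↔ IsOverlap P b' s lo hi lo' hi'

variable {P : Finset (ℝ × ℝ)} {v b b' : ℝ} {s s' : Corner}

theorem isStairVertex_iff {p : ℝ × ℝ} : IsStairVertex P b s p ↔
    p ∈ P ∧ ∀ q ∈ P, s.sgnY * p.2 < s.sgnY * q.2 → s.sgnX * skewX b q ≤ s.sgnX * skewX b p := by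
  simp only [IsStairVertex, IsFree, mem_quadrant, not_and', not_lt]

theorem exists_isExtreme (h : ∃ p ∈ P, s.sgnY * v < s.sgnY * p.2) :
    ∃ p, IsExtreme P b s v p := by
  obtain ⟨p, hp, hm⟩ := (P.filter fun p => s.sgnY * v < s.sgnY * p.2).exists_max_image
    (fun p => s.sgnX * skewX b p) (by simpa [Finset.Nonempty] using h)
  rw [Finset.mem_filter] at hp
  exact ⟨p, hp.1, hp.2, fun q hq h => hm q (Finset.mem_filter.2 ⟨hq, h⟩)⟩

theorem IsExtreme.isStairVertex {p : ℝ × ℝ} (h : IsExtreme P b s v p) :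
    IsStairVertex P b s p :=
  isStairVertex_iff.2 ⟨h.1, fun q hq hpq => h.2.2 q hq (h.2.1.trans hpq)⟩

theorem sgnX_mul_lt_of_le {p q : ℝ × ℝ} (hb : InjOn (skewX b) P) (hp : p ∈ P) (hq : q ∈ P)
    (hne : p ≠ q) (h : s.sgnX * skewX b p ≤ s.sgnX * skewX b q) :
    s.sgnX * skewX b p < s.sgnX * skewX b q :=
  h.lt_of_ne fun e => hne (hb hp hq (mul_left_cancel₀ s.sgnX_ne_zero e))

/-- The extreme points for `b` and `b'` are staircase vertices at both angles. If they differed, the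
one closer to height `v` would, as a vertex, be at least as far out as the other, at the very angle
where the other is strictly extreme. -/
theorem IsExtreme.congr (hhor : ∀ p ∈ P, ∀ q ∈ P, p ≠ q → p.2 ≠ q.2) (hs : Similar P b b')
    {p : ℝ × ℝ} (h : IsExtreme P b s v p) : IsExtreme P b' s v p := by
  obtain ⟨q, hq⟩ := exists_isExtreme (b := b') ⟨p, h.1, h.2.1⟩
  suffices p = q from this ▸ hq
  by_contra hne
  have hy : s.sgnY * p.2 ≠ s.sgnY * q.2 := fun e =>
    hhor p h.1 q hq.1 hne (mul_left_cancel₀ s.sgnY_ne_zero e)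
  rcases hy.lt_or_gt with hlt | hlt
  · have h1 := (isStairVertex_iff.1 ((hs.stair s p).1 h.isStairVertex)).2 q hq.1 hlt
    exact (sgnX_mul_lt_of_le hs.injOn' h.1 hq.1 hne (hq.2.2 p h.1 h.2.1)).not_ge h1
  · have h1 := (isStairVertex_iff.1 ((hs.stair s q).2 hq.isStairVertex)).2 p h.1 hlt
    exact (sgnX_mul_lt_of_le hs.injOn hq.1 h.1 (Ne.symm hne) (h.2.2 q hq.1 hq.2.1)).not_ge h1

/-- If `j` beats `i`, it beats all of `P` and is therefore a vertex of the staircase of type `s`.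
This survives at `b'`, and since `i` lies beyond `j` vertically, `i` cannot overtake it. -/
theorem IsExtreme.lt_congr_same_side (hv : ∀ p ∈ P, p.2 ≠ v) (hs : Similar P b b')
    (hX : s'.sgnX = s.sgnX) (hY : s'.sgnY = -s.sgnY) {i j : ℝ × ℝ} (hi : IsExtreme P b s v i)
    (hj : IsExtreme P b s' v j) (h : s.sgnX * skewX b i < s.sgnX * skewX b j) :
    s.sgnX * skewX b' i < s.sgnX * skewX b' j := by
  obtain ⟨hjP, hjv, hjm⟩ := hj
  rw [hX] at hjm
  rw [hY] at hjv hjm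
  have hst : IsStairVertex P b s j := by
    refine isStairVertex_iff.2 ⟨hjP, fun q hq _ => ?_⟩
    have hy : s.sgnY * v ≠ s.sgnY * q.2 := fun e =>
      hv q hq (mul_left_cancel₀ s.sgnY_ne_zero e).symm
    rcases hy.lt_or_gt with hlt | hlt
    · exact (hi.2.2 q hq hlt).trans h.le
    · exact hjm q hq (by linarith)
  have hij : i ≠ j := fun e => by rw [e] at h; exact h.false
  have hle := (isStairVertex_iff.1 ((hs.stair s j).1 hst)).2 i hi.1 (by linarith [hi.2.1])
  exact sgnX_mul_lt_of_le hs.injOn' hi.1 hjP hij hle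

/-- The extreme point above `v` is the lowest staircase vertex above `v`; its lower neighbour is the
highest vertex below `v`, and `r` ensures that there is one. -/
theorem exists_isConsecutive_above
    (hb : InjOn (skewX b) P) (hv : ∀ p ∈ P, p.2 ≠ v) (hs : s.sgnY = 1) {i r : ℝ × ℝ}
    (hi : IsExtreme P b s v i) (hr : IsStairVertex P b s r) (hrv : r.2 < v) :
    ∃ lo, lo.2 < v ∧ IsConsecutive P b s lo i := by
  classical
  obtain ⟨lo, hlo, hmax⟩ := (P.filter fun p => IsStairVertex P b s p ∧ p.2 < v).exists_max_image
    Prod.snd ⟨r, Finset.mem_filter.2 ⟨hr.1, hr, hrv⟩⟩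
  obtain ⟨hloP, hlo, hlov⟩ := Finset.mem_filter.1 hlo
  have hiv : v < i.2 := by simpa [hs] using hi.2.1
  refine ⟨lo, hlov, hlo, hi.isStairVertex, hlov.trans hiv, fun q hq ⟨h1, h2⟩ => ?_⟩
  rcases (hv q hq.1).lt_or_gt with hqv | hqv
  · exact (hmax q (Finset.mem_filter.2 ⟨hq.1, hq, hqv⟩)).not_gt h1
  · have h3 := (isStairVertex_iff.1 hq).2 i hi.1 (by simpa [hs] using h2)
    have hne : q ≠ i := fun e => by rw [e] at h2; exact h2.false
    exact (sgnX_mul_lt_of_le hb hq.1 hi.1 hne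
      (hi.2.2 q hq.1 (by simpa [hs] using hqv))).not_ge h3

theorem exists_isConsecutive_below
    (hb : InjOn (skewX b) P) (hv : ∀ p ∈ P, p.2 ≠ v) (hs : s.sgnY = -1) {i r : ℝ × ℝ}
    (hi : IsExtreme P b s v i) (hr : IsStairVertex P b s r) (hrv : v < r.2) :
    ∃ hi, v < hi.2 ∧ IsConsecutive P b s i hi := by
  classical
  obtain ⟨lo, hlo, hmin⟩ := (P.filter fun p => IsStairVertex P b s p ∧ v < p.2).exists_min_image
    Prod.snd ⟨r, Finset.mem_filter.2 ⟨hr.1, hr, hrv⟩⟩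
  obtain ⟨hloP, hlo, hlov⟩ := Finset.mem_filter.1 hlo
  have hiv : i.2 < v := by simpa [hs] using hi.2.1
  refine ⟨lo, hlov, hi.isStairVertex, hlo, hiv.trans hlov, fun q hq ⟨h1, h2⟩ => ?_⟩
  rcases (hv q hq.1).lt_or_gt with hqv | hqv
  · have h3 := (isStairVertex_iff.1 hq).2 i hi.1 (by simpa [hs] using h1)
    have hne : q ≠ i := fun e => by rw [e] at h1; exact h1.false
    exact (sgnX_mul_lt_of_le hb hq.1 hi.1 hne
      (hi.2.2 q hq.1 (by simpa [hs] using hqv))).not_ge h3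
  · exact (hmin q (Finset.mem_filter.2 ⟨hq.1, hq, hqv⟩)).not_gt h2

theorem quadrant_inter_opposite_nonempty_iff {a a' : ℝ × ℝ} :
    (quadrant b s a ∩ quadrant b s.opposite a').Nonempty ↔
      s.sgnX * skewX b a < s.sgnX * skewX b a' ∧ s.sgnY * a.2 < s.sgnY * a'.2 := by
  constructor
  · rintro ⟨z, hz, hz'⟩
    rw [mem_quadrant] at hz hz'
    rw [s.sgnX_opposite, s.sgnY_opposite] at hz'
    constructor <;> linarith [hz.1, hz.2, hz'.1, hz'.2]
  · rintro ⟨h1, h2⟩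
    obtain ⟨z, hz1, hz2⟩ := exists_skewX_eq b ((skewX b a + skewX b a') / 2) ((a.2 + a'.2) / 2)
    refine ⟨z, ?_, ?_⟩ <;> rw [mem_quadrant, hz1, hz2]
    · constructor <;> linarith
    · rw [s.sgnX_opposite, s.sgnY_opposite]
      constructor <;> linarith

theorem skewX_apex_of_top (hs : s.sgnY = 1) (lo hi : ℝ × ℝ) :
    skewX b (apex b s lo hi) = skewX b hi ∧ (apex b s lo hi).2 = lo.2 := by
  cases s <;> simp [Corner.sgnY] at hs <;> simp [apex, skewX] <;> norm_num at hs

theorem skewX_apex_of_bottom (hs : s.sgnY = -1) (lo hi : ℝ × ℝ) :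
    skewX b (apex b s lo hi) = skewX b lo ∧ (apex b s lo hi).2 = hi.2 := by
  cases s <;> simp [Corner.sgnY] at hs <;> simp [apex, skewX] <;> norm_num at hs

theorem isOverlap_iff_of_top (hs : s.sgnY = 1) {lo hi lo' hi' : ℝ × ℝ} :
    IsOverlap P b s lo hi lo' hi' ↔ IsConsecutive P b s lo hi ∧
      IsConsecutive P b s.opposite lo' hi' ∧
        s.sgnX * skewX b hi < s.sgnX * skewX b lo' ∧ lo.2 < hi'.2 := by
  have hs' : s.opposite.sgnY = -1 := by rw [s.sgnY_opposite, hs]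
  rw [IsOverlap, quadrant_inter_opposite_nonempty_iff, (skewX_apex_of_top hs lo hi).1,
    (skewX_apex_of_top hs lo hi).2, (skewX_apex_of_bottom hs' lo' hi').1,
    (skewX_apex_of_bottom hs' lo' hi').2, hs, one_mul, one_mul]

/-- The inequality says that the opposite bounds cross, so that two maximal quadrants overlap around
height `v`. The overlapping region persists at `b'`, and the same inequality is read off from it
there. -/
theorem IsExtreme.lt_congr_opposite (hv : ∀ p ∈ P, p.2 ≠ v) (hs : Similar P b b')
    (hY : s.sgnY = 1) {i l : ℝ × ℝ} (hi : IsExtreme P b s v i) (hl : IsExtreme P b s.opposite v l)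
    (h : s.sgnX * skewX b i < s.sgnX * skewX b l) :
    s.sgnX * skewX b' i < s.sgnX * skewX b' l := by
  have hY' : s.opposite.sgnY = -1 := by rw [s.sgnY_opposite, hY]
  -- The global extremes are staircase vertices on the other side of `v` from `i` and `l`
  -- respectively, so each of `i` and `l` has a consecutive vertex across `v`.
  obtain ⟨j, hj, hjm⟩ := P.exists_max_image (fun p => s.sgnX * skewX b p) ⟨i, hi.1⟩
  obtain ⟨k, hk, hkm⟩ := P.exists_min_image (fun p => s.sgnX * skewX b p) ⟨i, hi.1⟩
  have hjv : j.2 < v := by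
    refine (hv j hj).lt_of_le (not_lt.1 fun hjv => ?_)
    have := hi.2.2 j hj (by simpa [hY] using hjv)
    linarith [hjm l hl.1]
  have hkv : v < k.2 := by
    refine (hv k hk).symm.lt_of_le (not_lt.1 fun hkv => ?_)
    have := hl.2.2 k hk (by simpa [hY'] using hkv)
    rw [s.sgnX_opposite] at this
    linarith [hkm i hi.1]
  obtain ⟨lo, hlov, hlo⟩ := exists_isConsecutive_above hs.injOn hv hY hi
    (isStairVertex_iff.2 ⟨hj, fun q hq _ => hjm q hq⟩) hjv
  obtain ⟨hi', hhiv, hhi⟩ := exists_isConsecutive_below hs.injOn hv hY' hl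
    (isStairVertex_iff.2 ⟨hk, fun q hq _ => by
      rw [s.sgnX_opposite]
      linarith [hkm q hq]⟩) hkv
  exact ((isOverlap_iff_of_top hY).1 ((hs.overlap s lo i l hi').1
    ((isOverlap_iff_of_top hY).2 ⟨hlo, hhi, h, hlov.trans hhiv⟩))).2.2.1

theorem width_eq_of_isExtreme (hv : ∀ p ∈ P, p.2 ≠ v) {i j k l : ℝ × ℝ}
    (hi : IsExtreme P b .topRight v i) (hj : IsExtreme P b .bottomRight v j)
    (hk : IsExtreme P b .topLeft v k) (hl : IsExtreme P b .bottomLeft v l) :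
    width P v b =
      max 0 (min (skewX b i) (skewX b j) - max (skewX b k) (skewX b l)) := by
  simp only [IsExtreme, Corner.sgnX, Corner.sgnY, one_mul, neg_one_mul, neg_le_neg_iff,
    neg_lt_neg_iff] at hi hj hk hl
  have hi' := mem_above.2 ⟨hi.1, hi.2.1⟩
  have hj' := mem_below.2 ⟨hj.1, hj.2.1⟩
  have hk' := mem_above.2 ⟨hk.1, hk.2.1⟩
  have hl' := mem_below.2 ⟨hl.1, hl.2.1⟩
  rw [width_eq hv ⟨i, hi'⟩ ⟨j, hj'⟩]
  congr 3
  · exact le_antisymm (Finset.sup'_le _ _ fun q hq =>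
      hi.2.2 q (mem_above.1 hq).1 (mem_above.1 hq).2) (Finset.le_sup' _ hi')
  · exact le_antisymm (Finset.sup'_le _ _ fun q hq =>
      hj.2.2 q (mem_below.1 hq).1 (mem_below.1 hq).2) (Finset.le_sup' _ hj')
  · exact le_antisymm (Finset.inf'_le _ hk') (Finset.le_inf' _ _ fun q hq =>
      hk.2.2 q (mem_above.1 hq).1 (mem_above.1 hq).2)
  · exact le_antisymm (Finset.inf'_le _ hl') (Finset.le_inf' _ _ fun q hq =>
      hl.2.2 q (mem_below.1 hq).1 (mem_below.1 hq).2)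

/-- As long as staircases and overlapping regions do not change, the length of a slice of the hull
is an affine function of the cotangent. -/
theorem exists_width_eq_affine (hhor : ∀ p ∈ P, ∀ q ∈ P, p ≠ q → p.2 ≠ q.2)
    (hv : ∀ p ∈ P, p.2 ≠ v) {N : Set ℝ} (hN : ∀ b ∈ N, ∀ b' ∈ N, Similar P b b') :
    ∃ A B : ℝ, ∀ b ∈ N, width P v b = A + B * Real.cot b := by
  rcases N.eq_empty_or_nonempty with rfl | ⟨c, hc⟩
  · exact ⟨0, 0, by simp⟩
  rcases (above P v).eq_empty_or_nonempty with hU | ⟨p, hp⟩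
  · exact ⟨0, 0, fun b _ => by simp [width_of_above_eq_empty hv hU]⟩
  rcases (below P v).eq_empty_or_nonempty with hD | ⟨q, hq⟩
  · exact ⟨0, 0, fun b _ => by simp [width_of_below_eq_empty hv hD]⟩
  rw [mem_above] at hp
  rw [mem_below] at hq
  obtain ⟨i, hi⟩ : ∃ i, ∀ b ∈ N, IsExtreme P b .topRight v i :=
    (exists_isExtreme ⟨p, hp.1, by simpa [Corner.sgnY] using hp.2⟩).imp
      fun _ h b hb => h.congr hhor (hN c hc b hb)
  obtain ⟨j, hj⟩ : ∃ j, ∀ b ∈ N, IsExtreme P b .bottomRight v j :=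
    (exists_isExtreme ⟨q, hq.1, by simpa [Corner.sgnY] using hq.2⟩).imp
      fun _ h b hb => h.congr hhor (hN c hc b hb)
  obtain ⟨k, hk⟩ : ∃ k, ∀ b ∈ N, IsExtreme P b .topLeft v k :=
    (exists_isExtreme ⟨p, hp.1, by simpa [Corner.sgnY] using hp.2⟩).imp
      fun _ h b hb => h.congr hhor (hN c hc b hb)
  obtain ⟨l, hl⟩ : ∃ l, ∀ b ∈ N, IsExtreme P b .bottomLeft v l :=
    (exists_isExtreme ⟨q, hq.1, by simpa [Corner.sgnY] using hq.2⟩).imp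
      fun _ h b hb => h.congr hhor (hN c hc b hb)
  have hik : ∀ b ∈ N, skewX b k ≤ skewX b i := fun b hb => by
    simpa [Corner.sgnX] using (hi b hb).2.2 k (hk b hb).1 (hk b hb).2.1
  have hjl : ∀ b ∈ N, skewX b l ≤ skewX b j := fun b hb => by
    simpa [Corner.sgnX] using (hj b hb).2.2 l (hl b hb).1 (hl b hb).2.1
  -- If a strict inequality at one angle of `N` holds at all of them, the sign of the difference is
  -- weakly constant on `N`.
  have key : ∀ x y : ℝ × ℝ, (∀ b ∈ N, ∀ b' ∈ N, skewX b x < skewX b y →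
      skewX b' x < skewX b' y) →
      (∀ b ∈ N, skewX b x ≤ skewX b y) ∨ ∀ b ∈ N, skewX b y ≤ skewX b x := by
    intro x y h
    by_cases hx : ∃ b ∈ N, skewX b x < skewX b y
    · obtain ⟨b, hb, hx⟩ := hx
      exact .inl fun b' hb' => (h b hb b' hb' hx).le
    · push Not at hx
      exact .inr hx
  have hij := key i j fun b hb b' hb' h => by
    have := (hi b hb).lt_congr_same_side (s := .topRight) (s' := .bottomRight) hv
      (hN b hb b' hb') rfl rfl (hj b hb)
    simp only [Corner.sgnX, one_mul] at this
    exact this h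
  have hlk := key l k fun b hb b' hb' h => by
    have := (hk b hb).lt_congr_same_side (s := .topLeft) (s' := .bottomLeft) hv
      (hN b hb b' hb') rfl rfl (hl b hb)
    simp only [Corner.sgnX, neg_one_mul, neg_lt_neg_iff] at this
    exact this h
  have hil := key i l fun b hb b' hb' h => by
    have := (hi b hb).lt_congr_opposite hv (hN b hb b' hb') rfl (hl b hb)
    simp only [Corner.sgnX, one_mul] at this
    exact this h
  have hjk := key j k fun b hb b' hb' h => by
    have := (hk b hb).lt_congr_opposite hv (hN b hb b' hb') rfl (hj b hb)
    simp only [Corner.sgnX, neg_one_mul, neg_lt_neg_iff] at this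
    exact this h
  obtain ⟨x, hx, hx'⟩ : ∃ x, (∀ b ∈ N, min (skewX b i) (skewX b j) = skewX b x) ∧
      (x = i ∨ x = j) := by
    rcases hij with h | h
    · exact ⟨i, fun b hb => min_eq_left (h b hb), .inl rfl⟩
    · exact ⟨j, fun b hb => min_eq_right (h b hb), .inr rfl⟩
  obtain ⟨y, hy, hy'⟩ : ∃ y, (∀ b ∈ N, max (skewX b k) (skewX b l) = skewX b y) ∧
      (y = k ∨ y = l) := by
    rcases hlk with h | h
    · exact ⟨k, fun b hb => max_eq_left (h b hb), .inl rfl⟩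
    · exact ⟨l, fun b hb => max_eq_right (h b hb), .inr rfl⟩
  -- Bounds coming from the same side of `v` never cross; for the two mixed pairs the overlapping
  -- regions decide.
  have hxy : (∀ b ∈ N, skewX b x ≤ skewX b y) ∨ ∀ b ∈ N, skewX b y ≤ skewX b x := by
    rcases hx' with rfl | rfl <;> rcases hy' with rfl | rfl
    exacts [.inr hik, hil, hjk, .inr hjl]
  have hw : ∀ b ∈ N, width P v b = max 0 (skewX b x - skewX b y) := fun b hb => by
    rw [width_eq_of_isExtreme hv (hi b hb) (hj b hb) (hk b hb) (hl b hb), hx b hb, hy b hb]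
  rcases hxy with h | h
  · exact ⟨0, 0, fun b hb => by rw [hw b hb, max_eq_left (sub_nonpos.2 (h b hb))]; simp⟩
  · refine ⟨x.1 - y.1, -(x.2 - y.2), fun b hb => ?_⟩
    rw [hw b hb, max_eq_right (sub_nonneg.2 (h b hb)), skewX, skewX]
    ring

end OBeta
end

noncomputable section

namespace OBeta

variable {P : Finset (ℝ × ℝ)} {b b' β : ℝ}

/-! ### The order of the points and events -/

/-- The lines of slope `tan b` and those of slope `tan b'` meet the points of `P` in the same
order from left to right. -/
def SameOrder (P : Finset (ℝ × ℝ)) (b b' : ℝ) : Prop :=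
  ∀ p ∈ P, ∀ q ∈ P, skewX b p < skewX b q ↔ skewX b' p < skewX b' q

theorem SameOrder.sgnX_mul_le_iff (h : SameOrder P b b') (s : Corner) {p q : ℝ × ℝ} (hp : p ∈ P)
    (hq : q ∈ P) : s.sgnX * skewX b p ≤ s.sgnX * skewX b q ↔
      s.sgnX * skewX b' p ≤ s.sgnX * skewX b' q := by
  have h1 := h p hp q hq
  have h2 := h q hq p hp
  rw [← not_iff_not, not_le, not_le]
  cases s <;> simpa [Corner.sgnX]

theorem SameOrder.isStairVertex_iff (h : SameOrder P b b') (s : Corner) (p : ℝ × ℝ) :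
    IsStairVertex P b s p ↔ IsStairVertex P b' s p := by
  rw [OBeta.isStairVertex_iff, OBeta.isStairVertex_iff]
  refine and_congr_right fun hp => forall₂_congr fun q hq => ?_
  rw [h.sgnX_mul_le_iff s hq hp]

theorem SameOrder.isConsecutive_iff (h : SameOrder P b b') (s : Corner) (lo hi : ℝ × ℝ) :
    IsConsecutive P b s lo hi ↔ IsConsecutive P b' s lo hi := by
  simp only [IsConsecutive, h.isStairVertex_iff]

/-- In this form the condition depends on the angle only through skew comparisons of points of `P`,
so it is invariant under `SameOrder`. -/
theorem quadrant_inter_opposite_nonempty_iff_apex {s : Corner} {lo hi lo' hi' : ℝ × ℝ} :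
    (quadrant b s (apex b s lo hi) ∩
      quadrant b s.opposite (apex b s.opposite lo' hi')).Nonempty ↔
    if s.sgnY = 1 then ¬ s.sgnX * skewX b lo' ≤ s.sgnX * skewX b hi ∧ lo.2 < hi'.2
    else ¬ s.sgnX * skewX b hi' ≤ s.sgnX * skewX b lo ∧ lo'.2 < hi.2 := by
  rw [quadrant_inter_opposite_nonempty_iff, not_le, not_le]
  split_ifs with hs
  · have hs' : s.opposite.sgnY = -1 := by rw [s.sgnY_opposite, hs]
    rw [(skewX_apex_of_top hs lo hi).1,
      (skewX_apex_of_top hs lo hi).2, (skewX_apex_of_bottom hs' lo' hi').1,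
      (skewX_apex_of_bottom hs' lo' hi').2, hs, one_mul, one_mul]
  · have hs : s.sgnY = -1 := by
      cases s <;> simp_all [Corner.sgnY]
    have hs' : s.opposite.sgnY = 1 := by rw [s.sgnY_opposite, hs, neg_neg]
    rw [(skewX_apex_of_bottom hs lo hi).1,
      (skewX_apex_of_bottom hs lo hi).2, (skewX_apex_of_top hs' lo' hi').1,
      (skewX_apex_of_top hs' lo' hi').2, hs, neg_one_mul, neg_one_mul, neg_lt_neg_iff]

theorem SameOrder.isOverlap_iff (h : SameOrder P b b') (s : Corner) (lo hi lo' hi' : ℝ × ℝ) :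
    IsOverlap P b s lo hi lo' hi' ↔ IsOverlap P b' s lo hi lo' hi' := by
  rw [IsOverlap, IsOverlap, h.isConsecutive_iff, h.isConsecutive_iff]
  refine and_congr_right fun h1 => and_congr_right fun h2 => ?_
  rw [quadrant_inter_opposite_nonempty_iff_apex, quadrant_inter_opposite_nonempty_iff_apex,
    h.sgnX_mul_le_iff s h2.1.1 h1.2.1.1, h.sgnX_mul_le_iff s h2.2.1.1 h1.1.1]

theorem exists_sameOrder_of_eventually {l : Filter ℝ}
    (h : ∀ p ∈ P, ∀ q ∈ P, (∀ᶠ b in l, skewX b p < skewX b q) ∨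
      ∀ᶠ b in l, ¬ skewX b p < skewX b q) :
    ∃ N ∈ l, ∀ b ∈ N, ∀ b' ∈ N, SameOrder P b b' := by
  have : ∀ᶠ b in l, ∀ p ∈ P, ∀ q ∈ P,
      (skewX b p < skewX b q ↔ ∀ᶠ b in l, skewX b p < skewX b q) := by
    refine (Filter.eventually_all_finset P).2 fun p hp =>
      (Filter.eventually_all_finset P).2 fun q hq => ?_
    by_cases hpq : ∀ᶠ b in l, skewX b p < skewX b q
    · exact hpq.mono fun b hb => iff_of_true hb hpq
    · exact ((h p hp q hq).resolve_left hpq).mono fun b hb => iff_of_false hb hpq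
  exact ⟨_, this, fun b hb b' hb' p hp q hq => (hb p hp q hq).trans (hb' p hp q hq).symm⟩

/-! ### The order of the points near a single angle. -/

theorem skewX_sub_skewX (b b' : ℝ) (p q : ℝ × ℝ) :
    skewX b q - skewX b p =
      skewX b' q - skewX b' p + (q.2 - p.2) * (Real.cot b' - Real.cot b) := by
  simp only [skewX]
  ring

theorem eventually_skewX_lt {p q : ℝ × ℝ} (hβ : β ∈ Ioo 0 Real.pi)
    (h : skewX β p < skewX β q) : ∀ᶠ b in 𝓝 β, skewX b p < skewX b q :=
  (continuousAt_skewX hβ p).eventually_lt (continuousAt_skewX hβ q) h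

theorem eventually_cot_lt_of_gt (hβ : β ∈ Ioo 0 Real.pi) :
    ∀ᶠ b in 𝓝[>] β, Real.cot b < Real.cot β := by
  filter_upwards [Ioo_mem_nhdsGT hβ.2] with b hb
  exact strictAntiOn_cot hβ ⟨hβ.1.trans hb.1, hb.2⟩ hb.1

theorem eventually_lt_cot_of_lt (hβ : β ∈ Ioo 0 Real.pi) :
    ∀ᶠ b in 𝓝[<] β, Real.cot β < Real.cot b := by
  filter_upwards [Ioo_mem_nhdsLT hβ.1] with b hb
  exact strictAntiOn_cot ⟨hb.1, hb.2.trans hβ.2⟩ hβ hb.2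

/-- A tie at `β` is broken by the heights, since skew differences change at a rate proportional to
the height difference. -/
theorem eventually_lt_or_not_lt_nhdsGT (hβ : β ∈ Ioo 0 Real.pi) (p q : ℝ × ℝ) :
    (∀ᶠ b in 𝓝[>] β, skewX b p < skewX b q) ∨ ∀ᶠ b in 𝓝[>] β, ¬ skewX b p < skewX b q := by
  rcases lt_trichotomy (skewX β p) (skewX β q) with h | h | h
  · exact .inl ((eventually_skewX_lt hβ h).filter_mono nhdsWithin_le_nhds)
  · rcases lt_or_ge p.2 q.2 with h2 | h2
    · refine .inl ((eventually_cot_lt_of_gt hβ).mono fun b hb => ?_)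
      nlinarith [skewX_sub_skewX b β p q, mul_pos (sub_pos.2 h2) (sub_pos.2 hb)]
    · refine .inr ((eventually_cot_lt_of_gt hβ).mono fun b hb => ?_)
      nlinarith [skewX_sub_skewX b β p q, mul_nonneg (sub_nonneg.2 h2) (sub_pos.2 hb).le]
  · exact .inr (((eventually_skewX_lt hβ h).filter_mono nhdsWithin_le_nhds).mono
      fun _ => not_lt_of_gt)

theorem eventually_lt_or_not_lt_nhdsLT (hβ : β ∈ Ioo 0 Real.pi) (p q : ℝ × ℝ) :
    (∀ᶠ b in 𝓝[<] β, skewX b p < skewX b q) ∨ ∀ᶠ b in 𝓝[<] β, ¬ skewX b p < skewX b q := by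
  rcases lt_trichotomy (skewX β p) (skewX β q) with h | h | h
  · exact .inl ((eventually_skewX_lt hβ h).filter_mono nhdsWithin_le_nhds)
  · rcases lt_or_ge q.2 p.2 with h2 | h2
    · refine .inl ((eventually_lt_cot_of_lt hβ).mono fun b hb => ?_)
      nlinarith [skewX_sub_skewX b β p q, mul_pos (sub_pos.2 h2) (sub_pos.2 hb)]
    · refine .inr ((eventually_lt_cot_of_lt hβ).mono fun b hb => ?_)
      nlinarith [skewX_sub_skewX b β p q, mul_nonneg (sub_nonneg.2 h2) (sub_pos.2 hb).le]
  · exact .inr (((eventually_skewX_lt hβ h).filter_mono nhdsWithin_le_nhds).mono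
      fun _ => not_lt_of_gt)

theorem eventually_injOn_skewX (hhor : ∀ p ∈ P, ∀ q ∈ P, p ≠ q → p.2 ≠ q.2)
    (hβ : β ∈ Ioo 0 Real.pi) : ∀ᶠ b in 𝓝[≠] β, InjOn (skewX b) P := by
  have : ∀ᶠ b in 𝓝[≠] β, ∀ p ∈ P, ∀ q ∈ P, p ≠ q → skewX b p ≠ skewX b q := by
    refine (Filter.eventually_all_finset P).2 fun p hp =>
      (Filter.eventually_all_finset P).2 fun q hq => ?_
    by_cases hpq : p = q
    · exact .of_forall fun _ h => (h hpq).elim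
    rcases lt_trichotomy (skewX β p) (skewX β q) with h | h | h
    · exact nhdsWithin_le_nhds ((eventually_skewX_lt hβ h).mono fun _ h _ => h.ne)
    · filter_upwards [self_mem_nhdsWithin,
        nhdsWithin_le_nhds (isOpen_Ioo.mem_nhds hβ)] with b hb hb0 _ h'
      have h1 := skewX_sub_skewX b β p q
      rw [h, h', sub_self, sub_self, zero_add, eq_comm, mul_eq_zero, sub_eq_zero,
        sub_eq_zero] at h1
      rcases h1 with h1 | h1
      · exact hhor p hp q hq hpq h1.symm
      · exact hb (strictAntiOn_cot.injOn hb0 hβ h1.symm)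
    · exact nhdsWithin_le_nhds ((eventually_skewX_lt hβ h).mono fun _ h _ => h.ne')
  filter_upwards [this] with b hb p hp q hq h
  by_contra hne
  exact hb p hp q hq hne h

theorem iff_of_not_startsAt_of_not_stopsAt {F : ℝ → Prop} {L R : Set ℝ} (hL : L ∈ 𝓝[<] β)
    (hR : R ∈ 𝓝[>] β) (hFL : ∀ b ∈ L, ∀ b' ∈ L, F b ↔ F b')
    (hFR : ∀ b ∈ R, ∀ b' ∈ R, F b ↔ F b') (h1 : ¬ StartsAt F β) (h2 : ¬ StopsAt F β) :
    ∀ b ∈ L ∪ R, ∀ b' ∈ L ∪ R, F b ↔ F b' := by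
  have key : ∀ b ∈ L, ∀ b' ∈ R, F b ↔ F b' := by
    intro b hb b' hb'
    by_cases h : F b <;> by_cases h' : F b'
    · exact iff_of_true h h'
    · exact (h2 ⟨mem_of_superset hL fun c hc => (hFL b hb c hc).1 h,
        mem_of_superset hR fun c hc => mt (hFR b' hb' c hc).2 h'⟩).elim
    · exact (h1 ⟨mem_of_superset hL fun c hc => mt (hFL b hb c hc).2 h,
        mem_of_superset hR fun c hc => (hFR b' hb' c hc).1 h'⟩).elim
    · exact iff_of_false h h'
  rintro b (hb | hb) b' (hb' | hb')
  exacts [hFL b hb b' hb', key b hb b' hb', (key b' hb' b hb).symm, hFR b hb b' hb']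

/-- On each side of `β` the order is constant, hence so are staircases and overlaps; a discrepancy
between the sides would be an event. The angle `β` itself is left out because two points may be tied
there. -/
theorem exists_similar_of_notMem_events (hhor : ∀ p ∈ P, ∀ q ∈ P, p ≠ q → p.2 ≠ q.2)
    (hβ : β ∈ Ioo 0 Real.pi) (h : β ∉ events P) :
    ∃ N ∈ 𝓝[≠] β, ∀ b ∈ N, ∀ b' ∈ N, Similar P b b' := by
  obtain ⟨L, hL, hLo⟩ := exists_sameOrder_of_eventually (P := P) fun p _ q _ =>
    eventually_lt_or_not_lt_nhdsLT hβ p q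
  obtain ⟨R, hR, hRo⟩ := exists_sameOrder_of_eventually (P := P) fun p _ q _ =>
    eventually_lt_or_not_lt_nhdsGT hβ p q
  have hLR : L ∪ R ∈ 𝓝[≠] β := by
    rw [← nhdsLT_sup_nhdsGT]
    exact union_mem_sup hL hR
  simp only [events, mem_ofPred_eq, not_and, not_or] at h
  obtain ⟨h1, h2, h3, h4⟩ := h hβ
  refine ⟨_, inter_mem hLR (eventually_injOn_skewX hhor hβ), fun b hb b' hb' =>
    ⟨hb.2, hb'.2, fun s p => ?_, fun s lo hi lo' hi' => ?_⟩⟩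
  · exact iff_of_not_startsAt_of_not_stopsAt (F := fun b => IsStairVertex P b s p) hL hR
      (fun b hb b' hb' => (hLo b hb b' hb').isStairVertex_iff s p)
      (fun b hb b' hb' => (hRo b hb b' hb').isStairVertex_iff s p)
      (fun h => h1 ⟨s, p, h⟩) (fun h => h2 ⟨s, p, h⟩) b hb.1 b' hb'.1
  · exact iff_of_not_startsAt_of_not_stopsAt (F := fun b => IsOverlap P b s lo hi lo' hi') hL hR
      (fun b hb b' hb' => (hLo b hb b' hb').isOverlap_iff s lo hi lo' hi')
      (fun b hb b' hb' => (hRo b hb b' hb').isOverlap_iff s lo hi lo' hi')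
      (fun h => h3 ⟨s, lo, hi, lo', hi', h⟩) (fun h => h4 ⟨s, lo, hi, lo', hi', h⟩)
      b hb.1 b' hb'.1

theorem not_startsAt_of_eventually_iff {F : ℝ → Prop} {N : Set ℝ} (hN : N ∈ 𝓝 β)
    (h : ∀ b ∈ N, ∀ b' ∈ N, F b ↔ F b') : ¬ StartsAt F β ∧ ¬ StopsAt F β := by
  have hβ := mem_of_mem_nhds hN
  have hl : ∀ᶠ b in 𝓝[<] β, b ∈ N := nhdsWithin_le_nhds hN
  have hr : ∀ᶠ b in 𝓝[>] β, b ∈ N := nhdsWithin_le_nhds hN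
  constructor <;> rintro ⟨h1, h2⟩ <;> obtain ⟨b, hb1, hb2⟩ := (h1.and hl).exists <;>
    obtain ⟨c, hc1, hc2⟩ := (h2.and hr).exists
  · exact hb1 ((h c hc2 b hb2).1 hc1)
  · exact hc1 ((h b hb2 c hc2).1 hb1)

/-! ### Finiteness and existence of events. -/

theorem exists_skewX_eq_of_mem_events (h : β ∈ events P) :
    ∃ p ∈ P, ∃ q ∈ P, p ≠ q ∧ skewX β p = skewX β q := by
  obtain ⟨hβ, h⟩ := h
  by_contra! hne
  obtain ⟨N, hN, hNo⟩ := exists_sameOrder_of_eventually (P := P) (l := 𝓝 β) fun p hp q hq => by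
    rcases eq_or_ne p q with rfl | hpq
    · exact .inr (.of_forall fun _ => lt_irrefl _)
    rcases (hne p hp q hq hpq).lt_or_gt with h | h
    · exact .inl (eventually_skewX_lt hβ h)
    · exact .inr ((eventually_skewX_lt hβ h).mono fun _ => not_lt_of_gt)
  have h1 := fun s p => not_startsAt_of_eventually_iff (F := fun b => IsStairVertex P b s p) hN
    fun b hb b' hb' => (hNo b hb b' hb').isStairVertex_iff s p
  have h2 := fun s lo hi lo' hi' => not_startsAt_of_eventually_iff
    (F := fun b => IsOverlap P b s lo hi lo' hi') hN
    fun b hb b' hb' => (hNo b hb b' hb').isOverlap_iff s lo hi lo' hi'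
  rcases h with ⟨s, p, h⟩ | ⟨s, p, h⟩ | ⟨s, lo, hi, lo', hi', h⟩ | ⟨s, lo, hi, lo', hi', h⟩
  exacts [(h1 s p).1 h, (h1 s p).2 h, (h2 s lo hi lo' hi').1 h, (h2 s lo hi lo' hi').2 h]

/-- The cotangent of an event is the inverse slope of a line through two points of `P`, and the
cotangent is injective. -/
theorem finite_events (hhor : ∀ p ∈ P, ∀ q ∈ P, p ≠ q → p.2 ≠ q.2) : (events P).Finite := by
  refine Finite.of_finite_image (f := Real.cot) ?_ fun a ha b hb => strictAntiOn_cot.injOn ha.1 hb.1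
  refine ((P ×ˢ P).image fun x : (ℝ × ℝ) × ℝ × ℝ =>
    (x.1.1 - x.2.1) / (x.1.2 - x.2.2)).finite_toSet.subset ?_
  rintro _ ⟨β, hβ, rfl⟩
  obtain ⟨p, hp, q, hq, hne, h⟩ := exists_skewX_eq_of_mem_events hβ
  refine Finset.mem_coe.2 (Finset.mem_image.2 ⟨(p, q), Finset.mk_mem_product hp hq, ?_⟩)
  rw [div_eq_iff (sub_ne_zero.2 (hhor p hp q hq hne))]
  simp only [skewX] at h
  linarith

theorem skewX_lt_iff_cot_lt {p q : ℝ × ℝ} (h : p.2 < q.2) :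
    skewX b p < skewX b q ↔ Real.cot b < (q.1 - p.1) / (q.2 - p.2) := by
  rw [lt_div_iff₀ (sub_pos.2 h), skewX, skewX]
  constructor <;> intro <;> linarith

/-- As `cot b` drops below the largest inverse slope from `p` to a higher point, that point enters
the top-right quadrant of `p`, which is a deletion event. -/
theorem nonempty_events (hcard : 2 ≤ P.card) (hhor : ∀ p ∈ P, ∀ q ∈ P, p ≠ q → p.2 ≠ q.2) :
    (events P).Nonempty := by
  obtain ⟨p, hp, q, hq, hpq⟩ : ∃ p ∈ P, ∃ q ∈ P, p.2 < q.2 := by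
    obtain ⟨p, hp, q, hq, hne⟩ := Finset.one_lt_card.1 hcard
    rcases (hhor p hp q hq hne).lt_or_gt with h | h
    exacts [⟨p, hp, q, hq, h⟩, ⟨q, hq, p, hp, h⟩]
  obtain ⟨r, hr, hmax⟩ := (above P p.2).exists_max_image
    (fun r => (r.1 - p.1) / (r.2 - p.2)) ⟨q, mem_above.2 ⟨hq, hpq⟩⟩
  rw [mem_above] at hr
  obtain ⟨β, hβ, hcot⟩ := exists_cot_eq ((r.1 - p.1) / (r.2 - p.2))
  refine ⟨β, hβ, .inr (.inl ⟨.topRight, p, ?_, ?_⟩)⟩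
  · filter_upwards [eventually_lt_cot_of_lt hβ] with b hb
    refine isStairVertex_iff.2 ⟨hp, fun x hx hpx => ?_⟩
    simp only [Corner.sgnX, Corner.sgnY, one_mul] at hpx ⊢
    rw [← not_lt, skewX_lt_iff_cot_lt hpx, not_lt]
    exact (hmax x (mem_above.2 ⟨hx, hpx⟩)).trans (hcot ▸ hb.le)
  · filter_upwards [eventually_cot_lt_of_gt hβ] with b hb h
    have := (isStairVertex_iff.1 h).2 r hr.1 (by simpa [Corner.sgnY] using hr.2)
    simp only [Corner.sgnX, one_mul] at this
    exact this.not_gt ((skewX_lt_iff_cot_lt hr.2).2 (hcot ▸ hb))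

end OBeta
end

noncomputable section

namespace OBeta

variable {P : Finset (ℝ × ℝ)} {v b β β₁ β₂ : ℝ}

/-! ### The area between events -/

/-- Continuity fills in the angle `β` missing from the punctured neighbourhood. -/
theorem exists_eventually_width_eq (hhor : ∀ p ∈ P, ∀ q ∈ P, p ≠ q → p.2 ≠ q.2)
    (hv : ∀ p ∈ P, p.2 ≠ v) (hβ : β ∈ Ioo 0 Real.pi) (h : β ∉ events P) :
    ∃ A B : ℝ, ∀ᶠ b in 𝓝 β, width P v b = A + B * Real.cot b := by
  obtain ⟨N, hN, hs⟩ := exists_similar_of_notMem_events hhor hβ h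
  obtain ⟨A, B, hAB⟩ := exists_width_eq_affine hhor hv hs
  have h1 : (fun b => width P v b) =ᶠ[𝓝[≠] β] fun b => A + B * Real.cot b :=
    mem_of_superset hN hAB
  exact ⟨A, B, ((continuousAt_width hv hβ).eventuallyEq_nhds_iff_eventuallyEq_nhdsNE
    (continuousAt_const.add (continuousAt_const.mul (continuousAt_cot hβ)))).1 h1⟩

theorem analyticAt_const_add_mul_cot (hβ : β ∈ Ioo 0 Real.pi) (A B : ℝ) :
    AnalyticAt ℝ (fun b => A + B * Real.cot b) β :=
  analyticAt_const.add (analyticAt_const.mul (analyticAt_cot hβ))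

/-- The local constants could vary with the angle; the identity theorem makes them the same on the
open interval, and continuity reaches the endpoints. -/
theorem exists_width_eq_on_Icc (hhor : ∀ p ∈ P, ∀ q ∈ P, p ≠ q → p.2 ≠ q.2)
    (hv : ∀ p ∈ P, p.2 ≠ v) (h₁ : β₁ ∈ Ioo 0 Real.pi) (h₂ : β₂ ∈ Ioo 0 Real.pi) (hlt : β₁ < β₂)
    (hfree : ∀ β ∈ Ioo β₁ β₂, β ∉ events P) :
    ∃ A B : ℝ, ∀ b ∈ Icc β₁ β₂, width P v b = A + B * Real.cot b := by
  have hsub : Icc β₁ β₂ ⊆ Ioo 0 Real.pi := fun b hb =>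
    ⟨h₁.1.trans_le hb.1, hb.2.trans_lt h₂.2⟩
  have hsub' := Ioo_subset_Icc_self.trans hsub
  have han : AnalyticOnNhd ℝ (fun b => width P v b) (Ioo β₁ β₂) := fun b hb => by
    obtain ⟨A, B, hAB⟩ := exists_eventually_width_eq hhor hv (hsub' hb) (hfree b hb)
    exact (analyticAt_const_add_mul_cot (hsub' hb) A B).congr (EventuallyEq.symm hAB)
  obtain ⟨m, hm⟩ := exists_between hlt
  obtain ⟨A, B, hAB⟩ := exists_eventually_width_eq hhor hv (hsub' hm) (hfree m hm)
  have heq := han.eqOn_of_preconnected_of_eventuallyEq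
    (fun b hb => analyticAt_const_add_mul_cot (hsub' hb) A B) isPreconnected_Ioo hm hAB
  exact ⟨A, B, heq.of_subset_closure
    (fun b hb => (continuousAt_width hv (hsub hb)).continuousWithinAt)
    (fun b hb => (analyticAt_const_add_mul_cot (hsub hb) A B).continuousAt.continuousWithinAt)
    Ioo_subset_Icc_self (closure_Ioo hlt.ne).ge⟩

theorem exists_area_eq_on_Icc (hhor : ∀ p ∈ P, ∀ q ∈ P, p ≠ q → p.2 ≠ q.2)
    (h₁ : β₁ ∈ Ioo 0 Real.pi) (h₂ : β₂ ∈ Ioo 0 Real.pi) (hlt : β₁ < β₂)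
    (hfree : ∀ β ∈ Ioo β₁ β₂, β ∉ events P) :
    ∃ A B : ℝ, ∀ b ∈ Icc β₁ β₂, area P b = A + B * Real.cot b := by
  set c₁ := Real.cot β₁ with hc₁
  set c₂ := Real.cot β₂ with hc₂
  have hc : c₁ - c₂ ≠ 0 := (sub_pos.2 (strictAntiOn_cot h₁ h₂ hlt)).ne'
  -- The constants of a slice depend on `v` with no known measurability. Interpolating between the
  -- two endpoint widths eliminates them and leaves an identity that can be integrated.
  have key : ∀ b ∈ Icc β₁ β₂, (c₁ - c₂) * area P b =
      (Real.cot b - c₂) * area P β₁ + (c₁ - Real.cot b) * area P β₂ := by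
    intro b hb
    simp only [area_eq_integral]
    rw [← integral_const_mul, ← integral_const_mul, ← integral_const_mul, ← integral_add
      ((integrable_width P β₁).const_mul _) ((integrable_width P β₂).const_mul _)]
    refine integral_congr_ae ((ae_forall_ne_snd P).mono fun v hv => ?_)
    obtain ⟨A, B, hAB⟩ := exists_width_eq_on_Icc hhor hv h₁ h₂ hlt hfree
    simp only [hAB b hb, hAB β₁ (left_mem_Icc.2 hlt.le), hAB β₂ (right_mem_Icc.2 hlt.le)]
    rw [← hc₁, ← hc₂]
    ring
  refine ⟨(c₁ * area P β₂ - c₂ * area P β₁) / (c₁ - c₂),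
    (area P β₁ - area P β₂) / (c₁ - c₂), fun b hb => mul_left_cancel₀ hc ?_⟩
  rw [key b hb]
  field_simp
  ring

theorem monotoneOn_or_antitoneOn_area (h₁ : β₁ ∈ Ioo 0 Real.pi) (h₂ : β₂ ∈ Ioo 0 Real.pi)
    (h : ∃ A B : ℝ, ∀ b ∈ Icc β₁ β₂, area P b = A + B * Real.cot b) :
    MonotoneOn (area P) (Icc β₁ β₂) ∨ AntitoneOn (area P) (Icc β₁ β₂) := by
  obtain ⟨A, B, hAB⟩ := h
  have hsub : Icc β₁ β₂ ⊆ Ioo 0 Real.pi := fun b hb =>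
    ⟨h₁.1.trans_le hb.1, hb.2.trans_lt h₂.2⟩
  have hanti := strictAntiOn_cot.antitoneOn.mono hsub
  rcases le_total B 0 with hB | hB
  · refine .inl fun x hx y hy hxy => ?_
    rw [hAB x hx, hAB y hy]
    nlinarith [hanti hx hy hxy]
  · refine .inr fun x hx y hy hxy => ?_
    rw [hAB x hx, hAB y hy]
    nlinarith [hanti hx hy hxy]

/-! ### The area before the first and after the last event -/

theorem width_eq_zero (hv : ∀ p ∈ P, p.2 ≠ v)
    (h : (∀ p ∈ below P v, ∀ q ∈ above P v, skewX b p ≤ skewX b q) ∨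
      ∀ p ∈ below P v, ∀ q ∈ above P v, skewX b q ≤ skewX b p) : width P v b = 0 := by
  rcases (above P v).eq_empty_or_nonempty with hU | hU
  · exact width_of_above_eq_empty hv hU b
  rcases (below P v).eq_empty_or_nonempty with hD | hD
  · exact width_of_below_eq_empty hv hD b
  rw [width_eq hv hU hD, max_eq_left]
  rw [sub_nonpos]
  rcases h with h | h
  · exact (min_le_right _ _).trans ((Finset.sup'_le _ _ fun p hp => Finset.le_inf' _ _
      fun q hq => h p hp q hq).trans (le_max_left _ _))
  · exact (min_le_left _ _).trans ((Finset.sup'_le _ _ fun q hq => Finset.le_inf' _ _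
      fun p hp => h p hp q hq).trans (le_max_right _ _))

/-- When the skew coordinate is monotone in height, the points above and below a slice are separated
horizontally and the bounds of the slice leave no length. -/
theorem area_eq_zero
    (h : (∀ p ∈ P, ∀ q ∈ P, p.2 < q.2 → skewX b p ≤ skewX b q) ∨
      ∀ p ∈ P, ∀ q ∈ P, p.2 < q.2 → skewX b q ≤ skewX b p) : area P b = 0 := by
  rw [area_eq_integral]
  refine integral_eq_zero_of_ae ((ae_forall_ne_snd P).mono fun v hv => width_eq_zero hv ?_)
  have hlt : ∀ p ∈ below P v, ∀ q ∈ above P v, p.2 < q.2 := fun p hp q hq =>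
    (mem_below.1 hp).2.trans (mem_above.1 hq).2
  exact h.imp
    (fun h p hp q hq => h p (mem_below.1 hp).1 q (mem_above.1 hq).1 (hlt p hp q hq))
    fun h p hp q hq => h p (mem_below.1 hp).1 q (mem_above.1 hq).1 (hlt p hp q hq)

/-- These are inverse slopes; pairs of equal height give the harmless value `0`. -/
theorem exists_forall_abs_slope_le (P : Finset (ℝ × ℝ)) :
    ∃ T : ℝ, ∀ p ∈ P, ∀ q ∈ P, |(q.1 - p.1) / (q.2 - p.2)| ≤ T := by
  obtain ⟨T, hT⟩ := ((P ×ˢ P).image fun x : (ℝ × ℝ) × ℝ × ℝ =>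
    |(x.2.1 - x.1.1) / (x.2.2 - x.1.2)|).bddAbove
  exact ⟨T, fun p hp q hq => hT (Finset.mem_coe.2 (Finset.mem_image.2
    ⟨(p, q), Finset.mk_mem_product hp hq, rfl⟩))⟩

theorem exists_area_eq_zero_of_lt (P : Finset (ℝ × ℝ)) :
    ∃ a ∈ Ioo 0 Real.pi, ∀ b ∈ Ioo 0 a, area P b = 0 := by
  obtain ⟨T, hT⟩ := exists_forall_abs_slope_le P
  obtain ⟨a, ha, hcot⟩ := exists_cot_eq T
  refine ⟨a, ha, fun b hb => area_eq_zero (.inr fun p hp q hq hpq => ?_)⟩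
  have h1 := strictAntiOn_cot ⟨hb.1, hb.2.trans ha.2⟩ ha hb.2
  rw [← not_lt, skewX_lt_iff_cot_lt hpq, not_lt]
  linarith [(abs_le.1 (hT p hp q hq)).2]

theorem exists_area_eq_zero_of_gt (P : Finset (ℝ × ℝ)) :
    ∃ a ∈ Ioo 0 Real.pi, ∀ b ∈ Ioo a Real.pi, area P b = 0 := by
  obtain ⟨T, hT⟩ := exists_forall_abs_slope_le P
  obtain ⟨a, ha, hcot⟩ := exists_cot_eq (-T)
  refine ⟨a, ha, fun b hb => area_eq_zero (.inl fun p hp q hq hpq => ?_)⟩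
  have h1 := strictAntiOn_cot ha ⟨ha.1.trans hb.1, hb.2⟩ hb.1
  refine ((skewX_lt_iff_cot_lt hpq).2 ?_).le
  linarith [(abs_le.1 (hT p hp q hq)).1]

theorem area_eq_zero_of_affine {I : Set ℝ} {x y : ℝ} (hI : I ⊆ Ioo 0 Real.pi) (hx : x ∈ I)
    (hy : y ∈ I) (hxy : x ≠ y) (hx0 : area P x = 0) (hy0 : area P y = 0)
    (h : ∃ A B : ℝ, ∀ b ∈ I, area P b = A + B * Real.cot b) : ∀ b ∈ I, area P b = 0 := by
  obtain ⟨A, B, hAB⟩ := h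
  have h1 := hAB x hx
  have h2 := hAB y hy
  rw [hx0] at h1
  rw [hy0] at h2
  have hB : B * (Real.cot x - Real.cot y) = 0 := by linarith
  have hB : B = 0 := (mul_eq_zero.1 hB).resolve_right
    (sub_ne_zero.2 fun e => hxy (strictAntiOn_cot.injOn (hI hx) (hI hy) e))
  intro b hb
  rw [hAB b hb]
  rw [hB] at h1 ⊢
  linarith

/-- Two zeros `x < y` of the area are taken close to `0`. No event lies strictly between `x` and
`β`, so the area is affine in the cotangent there, and the two zeros force it to vanish up to `β`.
-/
theorem area_eq_zero_of_forall_events_gt (hhor : ∀ p ∈ P, ∀ q ∈ P, p ≠ q → p.2 ≠ q.2)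
    (hβ : β ∈ Ioo 0 Real.pi) (h : ∀ e ∈ events P, β ≤ e) : area P β = 0 := by
  obtain ⟨a, ha, h0⟩ := exists_area_eq_zero_of_lt P
  obtain ⟨y, hy0, hy⟩ := exists_between (lt_min ha.1 hβ.1)
  obtain ⟨x, hx0, hx⟩ := exists_between hy0
  rw [lt_min_iff] at hy
  have hxβ := hx.trans hy.2
  refine area_eq_zero_of_affine (I := Icc x β) (fun b hb => ⟨hx0.trans_le hb.1, hb.2.trans_lt hβ.2⟩)
    (left_mem_Icc.2 hxβ.le) ⟨hx.le, hy.2.le⟩ hx.ne (h0 x ⟨hx0, hx.trans hy.1⟩)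
    (h0 y ⟨hy0, hy.1⟩) ?_ β (right_mem_Icc.2 hxβ.le)
  exact exists_area_eq_on_Icc hhor ⟨hx0, hxβ.trans hβ.2⟩ hβ hxβ
    fun b hb hbe => (h b hbe).not_gt hb.2

theorem area_eq_zero_of_forall_events_lt (hhor : ∀ p ∈ P, ∀ q ∈ P, p ≠ q → p.2 ≠ q.2)
    (hβ : β ∈ Ioo 0 Real.pi) (h : ∀ e ∈ events P, e ≤ β) : area P β = 0 := by
  obtain ⟨a, ha, h0⟩ := exists_area_eq_zero_of_gt P
  obtain ⟨y, hy, hyπ⟩ := exists_between (max_lt ha.2 hβ.2)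
  obtain ⟨x, hx, hxπ⟩ := exists_between hyπ
  rw [max_lt_iff] at hy
  have hxβ := hy.2.trans hx
  refine area_eq_zero_of_affine (I := Icc β x) (fun b hb => ⟨hβ.1.trans_le hb.1, hb.2.trans_lt hxπ⟩)
    (right_mem_Icc.2 hxβ.le) ⟨hy.2.le, hx.le⟩ hx.ne' (h0 x ⟨hy.1.trans hx, hxπ⟩)
    (h0 y ⟨hy.1, hyπ⟩) ?_ β (left_mem_Icc.2 hxβ.le)
  exact exists_area_eq_on_Icc hhor hβ ⟨hβ.1.trans hxβ, hxπ⟩ hxβ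
    fun b hb hbe => (h b hbe).not_gt hb.1

/-! ### The maximum is attained at an event. -/

theorem area_nonneg (P : Finset (ℝ × ℝ)) (β : ℝ) : 0 ≤ area P β := ENNReal.toReal_nonneg

theorem exists_isMax_area (hcard : 2 ≤ P.card) (hhor : ∀ p ∈ P, ∀ q ∈ P, p ≠ q → p.2 ≠ q.2) :
    ∃ β₀ ∈ events P, ∀ β ∈ Ioo 0 Real.pi, area P β ≤ area P β₀ := by
  have hfin := finite_events hhor
  obtain ⟨β₀, hβ₀, hmax⟩ := exists_max_image (events P) (area P) hfin (nonempty_events hcard hhor)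
  refine ⟨β₀, hβ₀, fun β hβ => ?_⟩
  by_cases hβe : β ∈ events P
  · exact hmax β hβe
  rcases (events P ∩ Iio β).eq_empty_or_nonempty with hL | hL
  · rw [area_eq_zero_of_forall_events_gt hhor hβ fun e he => not_lt.1 fun h =>
      (hL ▸ (⟨he, h⟩ : e ∈ events P ∩ Iio β) : e ∈ (∅ : Set ℝ))]
    exact area_nonneg P β₀
  rcases (events P ∩ Ioi β).eq_empty_or_nonempty with hR | hR
  · rw [area_eq_zero_of_forall_events_lt hhor hβ fun e he => not_lt.1 fun h =>
      (hR ▸ (⟨he, h⟩ : e ∈ events P ∩ Ioi β) : e ∈ (∅ : Set ℝ))]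
    exact area_nonneg P β₀
  obtain ⟨β₁, ⟨he₁, hlt₁⟩, hm₁⟩ := exists_max_image _ id (hfin.inter_of_left (Iio β)) hL
  obtain ⟨β₂, ⟨he₂, hlt₂⟩, hm₂⟩ := exists_min_image _ id (hfin.inter_of_left (Ioi β)) hR
  rw [mem_Iio] at hlt₁
  rw [mem_Ioi] at hlt₂
  have hlt := hlt₁.trans hlt₂
  have hfree : ∀ b ∈ Ioo β₁ β₂, b ∉ events P := fun b hb hbe => by
    rcases lt_trichotomy b β with h | rfl | h
    · exact (hm₁ b ⟨hbe, h⟩).not_gt hb.1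
    · exact hβe hbe
    · exact (hm₂ b ⟨hbe, h⟩).not_gt hb.2
  have hβI : β ∈ Icc β₁ β₂ := ⟨hlt₁.le, hlt₂.le⟩
  rcases monotoneOn_or_antitoneOn_area he₁.1 he₂.1
    (exists_area_eq_on_Icc hhor he₁.1 he₂.1 hlt hfree) with h | h
  · exact (h hβI (right_mem_Icc.2 hlt.le) hlt₂.le).trans (hmax β₂ he₂)
  · exact (h (left_mem_Icc.2 hlt.le) hβI hlt₁.le).trans (hmax β₁ he₁)

end OBeta
end

theorem mainTheorem6 (P : Finset (ℝ × ℝ)) (hcard : 2 ≤ P.card)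
    (hcollinear : ∀ p ∈ P, ∀ q ∈ P, ∀ r ∈ P, p ≠ q → p ≠ r → q ≠ r →
      ¬ Collinear ℝ ({p, q, r} : Set (ℝ × ℝ)))
    (hhorizontal : ∀ p ∈ P, ∀ q ∈ P, p ≠ q → p.2 ≠ q.2) :
    (OBeta.events P).Finite ∧
    (∃ β₀ ∈ OBeta.events P, ∀ β ∈ Set.Ioo 0 Real.pi, OBeta.area P β ≤ OBeta.area P β₀) ∧
    (∀ β₁ ∈ OBeta.events P, ∀ β₂ ∈ OBeta.events P, β₁ < β₂ →
      (∀ β ∈ Set.Ioo β₁ β₂, β ∉ OBeta.events P) →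
        (∃ A B : ℝ, ∀ β ∈ Set.Icc β₁ β₂, OBeta.area P β = A + B * Real.cot β) ∧
        (MonotoneOn (OBeta.area P) (Set.Icc β₁ β₂) ∨
          AntitoneOn (OBeta.area P) (Set.Icc β₁ β₂))) := by
  refine ⟨OBeta.finite_events hhorizontal, OBeta.exists_isMax_area hcard hhorizontal,
    fun β₁ h₁ β₂ h₂ hlt hfree => ?_⟩
  have h := OBeta.exists_area_eq_on_Icc hhorizontal h₁.1 h₂.1 hlt hfree
  exact ⟨h, OBeta.monotoneOn_or_antitoneOn_area h₁.1 h₂.1 h⟩
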